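/- **Model.** Processes $p_0,p_1,p_2,\dots$ communicate asynchronously by applying deterministic read-modify-write (RMW) primitives to shared base objects. A *set* stores integers, is initially empty, and exports $\mathtt{insert}(v)$ (returns true iff $v$ was absent), $\mathtt{remove}(v)$ (returns true iff $v$ was present) and the read-only operation (*search*) $\mathtt{contains}(v)$ (returns true iff $v$ is present). An *implementation* gives each process a deterministic program for the operations, whose events are invocations, RMWs on base objects, explicit flushes of base objects, persistence fences and responses, together with a deterministic sequential recovery procedure that uses RMWs, flushes and fences and that always terminates when no further crash interrupts it. RMWs act on volatile memory. A background flush may at any time atomically copy one base object from volatile to persistent memory; an explicit flush of $b$ by $p$ is asynchronous, and $b$ is copied at some time after it, at the latest at the next persistence fence of $p$. A (full-system) crash may occur at any time, also during recovery: volatile memory is replaced by the content of persistent memory, all processes return to their initial states, and the recovery procedure runs to completion before any operation is invoked. Executions are well-formed: a process invokes no operation before its previous one has returned, unless a crash has cut the previous one off. **Lock-freedom.** In every infinite crash-free execution fragment from a reachable configuration in which some process takes infinitely many steps, some operation completes (hence infinitely many do). **Strict linearizability.** A *strict completion* of the history of an execution is obtained by inserting matching responses for some of the operations without response, after the invocation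 and before the next crash (if any), and then removing the remaining operations without response and the crash events. The execution is strict linearizable if some strict completion is equivalent to a sequential history that extends its precedence order and is consistent with the specification of the set; such a sequential history is a *strict linearization*. **Key write.** Let $\pi$ be an update operation by $p$ in an execution. An RMW event $w$ of $p$ in $\pi$ that changes the value of its base object is a *key write* of $\pi$ if there are a process $p'$ and a search $\pi'$ that does not commute with $\pi$ such that both the solo run in which $p'$ invokes and completes $\pi'$ immediately before $w$ and the one immediately after $w$ exist, and $\pi'$ returns different responses in them. **SLE linearizability.** An implementation is *SLE linearizable* if each of its finite executions has a strict linearization in which every successful update (an $\mathtt{insert}$ or $\mathtt{remove}$ with response true) that was pending at a crash has a key write before that crash. **Persistence-free searches.** In no execution does a process perform an explicit flush or a persistence fence between the invocation and the response of one of its searches. **Theorem.** There is no lock-free SLE linearizable implementation of the set with persistence-free searches. -/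

import Mathlib

namespace PSet

/-! ### The abstract data type: a set of integers -/

/-- The operations of the set type. -/
inductive SetOp where
  | insert (v : ℤ)
  | remove (v : ℤ)
  | contains (v : ℤ)

/-- Sequential specification: new abstract state and Boolean response. -/
def SetOp.apply : SetOp → Finset ℤ → Finset ℤ × Bool
  | .insert v, s => (Insert.insert v s, decide (v ∉ s))
  | .remove v, s => (s.erase v, decide (v ∈ s))
  | .contains v, s => (s, decide (v ∈ s))

/-- `contains` operations are the searches, or read-only operations, of the type. -/
def SetOp.IsReadOnly : SetOp → Prop
  | .contains _ => True
  | _ => False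

/-- `insert` and `remove` are the update operations. -/
def SetOp.IsUpdate (o : SetOp) : Prop := ¬ o.IsReadOnly

/-- Two operations commute if, from every abstract state, both orders give both operations the same
responses and lead to the same state. -/
def SetOp.Commutes (o q : SetOp) : Prop :=
  ∀ s : Finset ℤ,
    (q.apply (o.apply s).1).1 = (o.apply (q.apply s).1).1 ∧
    (o.apply s).2 = (o.apply (q.apply s).1).2 ∧
    (q.apply (o.apply s).1).2 = (q.apply s).2

/-! ### Implementations

Processes are indexed by `ℕ`.  `B` is the type of base objects, `V` of their values, `S` of the local
states of processes and `R` of the local states of the recovery procedure. -/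

/-- The next step of a process that is executing an operation.  `rmw b f` applies the
read-modify-write primitive to `b` that maps the current value `v` to `(f v).1`; the local state after
it, which may depend on the response of the primitive, is `(f v).2`.  `respond r s` returns `r` from
the operation. -/
inductive Action (B V S : Type*) where
  | rmw (b : B) (f : V → V × S)
  | flush (b : B) (next : S)
  | fence (next : S)
  | respond (r : Bool) (next : S)

/-- The next step of the recovery procedure; `done` ends it. -/
inductive RecoveryAction (B V R : Type*) where
  | rmw (b : B) (f : V → V × R)
  | flush (b : B) (next : R)
  | fence (next : R)
  | done

/-- A (deterministic) implementation of the set from base objects. -/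
structure Implementation (B V S R : Type*) where
  /-- initial values of the base objects -/
  initVal : B → V
  /-- initial local states of the processes -/
  initState : ℕ → S
  /-- local state right after an invocation -/
  start : ℕ → S → SetOp → S
  /-- next step of a process that is executing an operation -/
  act : ℕ → S → Action B V S
  /-- initial state of the recovery procedure -/
  recInit : R
  /-- next step of the recovery procedure -/
  recAct : R → RecoveryAction B V R

/-- A process is between operations (`idle`) or executing one (`busy`). -/
inductive Status (S : Type*) where
  | idle (s : S)
  | busy (s : S)

/-- Configurations. -/
structure Config (B V S R : Type*) where
  /-- volatile shared memory -/
  vol : B → V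
  /-- persistent memory -/
  nvm : B → V
  /-- states of the processes -/
  proc : ℕ → Status S
  /-- explicit flushes of each process that need not have taken effect yet -/
  pend : ℕ → Set B
  /-- `some r` while the recovery procedure is running, in state `r` -/
  recovery : Option R
  /-- explicit flushes of the recovery procedure that need not have taken effect yet -/
  rpend : Set B

/-- Events.  The last four are the events of the recovery procedure. -/
inductive Event (B : Type*) where
  | invoke (p : ℕ) (o : SetOp)
  | rmw (p : ℕ) (b : B)
  | flush (p : ℕ) (b : B)
  | fence (p : ℕ)
  | respond (p : ℕ) (r : Bool)
  | bgFlush (b : B)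
  | crash
  | recRmw (b : B)
  | recFlush (b : B)
  | recFence
  | recDone

/-- `e.By p`: `e` is an event of process `p`. -/
def Event.By {B : Type*} : Event B → ℕ → Prop
  | .invoke q _, p => q = p
  | .rmw q _, p => q = p
  | .flush q _, p => q = p
  | .fence q, p => q = p
  | .respond q _, p => q = p
  | _, _ => False

/-- `e` is an event of the recovery procedure. -/
def Event.IsRecovery {B : Type*} : Event B → Prop
  | .recRmw _ => True
  | .recFlush _ => True
  | .recFence => True
  | .recDone => True
  | _ => False

section Semantics

variable {B V S R : Type*}

/-- The initial configuration. -/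
def Implementation.initConfig (I : Implementation B V S R) : Config B V S R where
  vol := I.initVal
  nvm := I.initVal
  proc p := .idle (I.initState p)
  pend _ := ∅
  recovery := none
  rpend := ∅

open Classical in
/-- Writing back the base objects in `A` from volatile to persistent memory. -/
noncomputable def Config.writeBack (C : Config B V S R) (A : Set B) : B → V :=
  fun b => if b ∈ A then C.vol b else C.nvm b

open Classical in
/-- One event.  Modifications act on volatile memory.  A background flush atomically writes one base
object back, at any time.  An explicit flush only becomes pending; it takes effect with the next
write-back of the object, which is either a background flush or, at the latest, the next fence of the
same process.  In a crash volatile memory is replaced by persistent memory, all processes return to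
their initial states, and no process takes a step before the recovery procedure is done. -/
inductive Step (I : Implementation B V S R) :
    Config B V S R → Event B → Config B V S R → Prop
  | invoke (C : Config B V S R) (p : ℕ) (s : S) (o : SetOp)
      (hr : C.recovery = none) (hp : C.proc p = .idle s) :
      Step I C (.invoke p o)
        { C with proc := Function.update C.proc p (.busy (I.start p s o)) }
  | rmw (C : Config B V S R) (p : ℕ) (s : S) (b : B) (f : V → V × S)
      (hr : C.recovery = none) (hp : C.proc p = .busy s) (ha : I.act p s = .rmw b f) :
      Step I C (.rmw p b)
        { C with
          vol := Function.update C.vol b (f (C.vol b)).1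
          proc := Function.update C.proc p (.busy (f (C.vol b)).2) }
  | flush (C : Config B V S R) (p : ℕ) (s : S) (b : B) (s' : S)
      (hr : C.recovery = none) (hp : C.proc p = .busy s) (ha : I.act p s = .flush b s') :
      Step I C (.flush p b)
        { C with
          pend := Function.update C.pend p (C.pend p ∪ {b})
          proc := Function.update C.proc p (.busy s') }
  | fence (C : Config B V S R) (p : ℕ) (s : S) (s' : S)
      (hr : C.recovery = none) (hp : C.proc p = .busy s) (ha : I.act p s = .fence s') :
      Step I C (.fence p)
        { C with
          nvm := C.writeBack (C.pend p)
          pend := fun q => C.pend q \ C.pend p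
          proc := Function.update C.proc p (.busy s') }
  | respond (C : Config B V S R) (p : ℕ) (s : S) (r : Bool) (s' : S)
      (hr : C.recovery = none) (hp : C.proc p = .busy s) (ha : I.act p s = .respond r s') :
      Step I C (.respond p r)
        { C with proc := Function.update C.proc p (.idle s') }
  | bgFlush (C : Config B V S R) (b : B) :
      Step I C (.bgFlush b)
        { C with
          nvm := C.writeBack {b}
          pend := fun q => C.pend q \ {b}
          rpend := C.rpend \ {b} }
  | crash (C : Config B V S R) :
      Step I C .crash
        { vol := C.nvm
          nvm := C.nvm
          proc := fun p => .idle (I.initState p)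
          pend := fun _ => ∅
          recovery := some I.recInit
          rpend := ∅ }
  | recRmw (C : Config B V S R) (r : R) (b : B) (f : V → V × R)
      (hr : C.recovery = some r) (ha : I.recAct r = .rmw b f) :
      Step I C (.recRmw b)
        { C with
          vol := Function.update C.vol b (f (C.vol b)).1
          recovery := some (f (C.vol b)).2 }
  | recFlush (C : Config B V S R) (r : R) (b : B) (r' : R)
      (hr : C.recovery = some r) (ha : I.recAct r = .flush b r') :
      Step I C (.recFlush b)
        { C with
          rpend := C.rpend ∪ {b}
          recovery := some r' }
  | recFence (C : Config B V S R) (r : R) (r' : R)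
      (hr : C.recovery = some r) (ha : I.recAct r = .fence r') :
      Step I C .recFence
        { C with
          nvm := C.writeBack C.rpend
          rpend := ∅
          recovery := some r' }
  | recDone (C : Config B V S R) (r : R)
      (hr : C.recovery = some r) (ha : I.recAct r = .done) :
      Step I C .recDone
        { C with
          rpend := ∅
          recovery := none }

/-- `Run I C es D`: the finite sequence of events `es` is an execution fragment from `C` to `D`. -/
inductive Run (I : Implementation B V S R) :
    Config B V S R → List (Event B) → Config B V S R → Prop
  | nil (C : Config B V S R) : Run I C [] C
  | cons {C D F : Config B V S R} {e : Event B} {es : List (Event B)}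
      (h : Step I C e D) (t : Run I D es F) : Run I C (e :: es) F

/-- `es` is a (finite) execution of `I`. -/
def Implementation.IsExecution (I : Implementation B V S R) (es : List (Event B)) : Prop :=
  ∃ C, Run I I.initConfig es C

/-- An infinite crash-free execution fragment that starts in a reachable configuration. -/
structure InfiniteRun (I : Implementation B V S R)
    (σ : ℕ → Config B V S R) (ev : ℕ → Event B) : Prop where
  reachable : ∃ es, Run I I.initConfig es (σ 0)
  step : ∀ n, Step I (σ n) (ev n) (σ (n + 1))
  crashFree : ∀ n, ev n ≠ .crash

/-- Lock-freedom: whenever some process keeps taking steps, some operation completes (and hence,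
by considering suffixes, infinitely many do). -/
def Implementation.LockFree (I : Implementation B V S R) : Prop :=
  ∀ σ ev, InfiniteRun I σ ev →
    (∃ p, ∀ N, ∃ n, N ≤ n ∧ (ev n).By p) → ∃ n q r, ev n = .respond q r

/-- The recovery procedure never runs forever. -/
def Implementation.RecoveryTerminates (I : Implementation B V S R) : Prop :=
  ∀ σ ev, InfiniteRun I σ ev → ¬ ∀ N, ∃ n, N ≤ n ∧ (ev n).IsRecovery

/-! ### Operations of an execution

Events are referred to by their index in the execution, and an operation by the index of its
invocation. -/

/-- The operation invoked by `p` at index `i` has neither responded nor been cut off by a crash at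
an index smaller than `j`. -/
def OngoingUntil (es : List (Event B)) (i : ℕ) (p : ℕ) (j : ℕ) : Prop :=
  (∃ o, es[i]? = some (.invoke p o)) ∧ i < j ∧
    ∀ m, i < m → m < j → es[m]? ≠ some .crash ∧ ∀ r, es[m]? ≠ some (.respond p r)

/-- The operation invoked by `p` at index `i` responds `r` at index `j`. -/
def RespondsAt (es : List (Event B)) (i : ℕ) (p : ℕ) (j : ℕ) (r : Bool) : Prop :=
  OngoingUntil es i p j ∧ es[j]? = some (.respond p r)

/-- The operation invoked by `p` at index `i` is pending when the crash at index `c` occurs. -/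
def PendingAtCrash (es : List (Event B)) (i : ℕ) (p : ℕ) (c : ℕ) : Prop :=
  OngoingUntil es i p c ∧ es[c]? = some .crash

/-- Searches are persistence-free: in no execution does a process perform an explicit flush or a
persistence fence between the invocation and the response of a read-only operation. -/
def Implementation.PersistenceFreeSearches (I : Implementation B V S R) : Prop :=
  ∀ es, I.IsExecution es → ∀ i j p o, es[i]? = some (.invoke p o) → o.IsReadOnly →
    OngoingUntil es i p j → es[j]? ≠ some (.fence p) ∧ ∀ b, es[j]? ≠ some (.flush p b)

/-! ### Strict linearizability -/

/-- A completed operation in a strict completion: process, operation, index of the invocation,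
position of the response, returned value. -/
structure OpRecord where
  proc : ℕ
  op : SetOp
  inv : ℕ
  res : ℕ
  ret : Bool

/-- `x` is an operation of a strict completion of the history of `es`.  Either it has the response
that occurs in `es`, at index `x.res`, or it has no response in `es` and the response `x.ret` is
inserted immediately before index `x.res`, which is after the invocation and not after the next
crash (or the end of `es`). -/
def OpRecord.Completes (x : OpRecord) (es : List (Event B)) : Prop :=
  es[x.inv]? = some (.invoke x.proc x.op) ∧
  OngoingUntil es x.inv x.proc x.res ∧ x.res ≤ es.length ∧
  (RespondsAt es x.inv x.proc x.res x.ret ∨ ¬ ∃ j r, RespondsAt es x.inv x.proc j r)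

/-- `x` responds before `y` is invoked. -/
def OpRecord.Precedes (x y : OpRecord) : Prop := x.res ≤ y.inv

/-- A sequence of operations with responses is consistent with the specification of the set. -/
def Legal : Finset ℤ → List OpRecord → Prop
  | _, [] => True
  | s, x :: l => (x.op.apply s).2 = x.ret ∧ Legal (x.op.apply s).1 l

/-- `l`, read as a sequential history, is a strict linearization of the history of `es`: its
operations are those of a strict completion (all operations that respond in `es` and some of the
others, each once), their order extends the precedence order of the strict completion (which
includes the order of the operations of each single process), and it is legal for a set that is
initially empty. -/
structure IsStrictLinearization (es : List (Event B)) (l : List OpRecord) : Prop where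
  completes : ∀ x ∈ l, x.Completes es
  nodup : (l.map OpRecord.inv).Nodup
  total : ∀ i p j r, RespondsAt es i p j r → ∃ x ∈ l, x.inv = i
  order : l.Pairwise fun x y => ¬ y.Precedes x
  legal : Legal ∅ l

/-! ### Key writes and SLE linearizability -/

/-- The solo run from `C` in which `p` invokes and completes the operation `q` exists, and it returns
`r`. -/
def SoloReturns (I : Implementation B V S R) (C : Config B V S R) (p : ℕ) (q : SetOp)
    (r : Bool) : Prop :=
  ∃ (es : List (Event B)) (D : Config B V S R),
    Run I C (.invoke p q :: (es ++ [.respond p r])) D ∧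
    ∀ e ∈ es, e.By p ∧ ∀ r', e ≠ .respond p r'

/-- The event at index `w` of `es` is a key write of the operation `o` that `p` invoked at index `i`:
it is a write by `p` in that operation, and some read-only operation `q` that does not commute with
`o`, run solo by some process `p'`, returns different responses immediately before and immediately
after it. -/
def IsKeyWrite (I : Implementation B V S R) (es : List (Event B)) (i : ℕ) (p : ℕ) (o : SetOp)
    (w : ℕ) : Prop :=
  es[i]? = some (.invoke p o) ∧ OngoingUntil es i p w ∧
  ∃ (b : B) (C D : Config B V S R),
    es[w]? = some (.rmw p b) ∧
    Run I I.initConfig (es.take w) C ∧ Run I I.initConfig (es.take (w + 1)) D ∧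
    D.vol b ≠ C.vol b ∧
    ∃ (p' : ℕ) (q : SetOp) (r r' : Bool), q.IsReadOnly ∧ ¬ o.Commutes q ∧
      SoloReturns I C p' q r ∧ SoloReturns I D p' q r' ∧ r ≠ r'

/-- SLE linearizability of an execution: it is strict linearizable, by a linearization in which every
successful update that was pending at a crash has a key write before that crash. -/
def SLEExecution (I : Implementation B V S R) (es : List (Event B)) : Prop :=
  ∃ l, IsStrictLinearization es l ∧
    ∀ x ∈ l, x.op.IsUpdate → x.ret = true → ∀ c, PendingAtCrash es x.inv x.proc c →
      ∃ w, w < c ∧ IsKeyWrite I es x.inv x.proc x.op w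

/-- The implementation is SLE linearizable. -/
def Implementation.SLELinearizable (I : Implementation B V S R) : Prop :=
  ∀ es, I.IsExecution es → SLEExecution I es

end Semantics

end PSet

/-! A key write lives in volatile memory, and a search that observes it can neither persist it nor
prevent a crash from erasing it. Let one process run `insert v` alone from the initial
configuration. A solo search for `v` fails at the start and must succeed at the end, and only a
value-changing RMW can alter its response, so the insertion has a key write (`exists_isKeyWrite`).
Take the first one, with configurations `C` just before it and `D` just after it. A search that
succeeded from `C` would, once a crash cuts the insertion off, force an earlier key write. So the
search fails from `C` and succeeds from `D`. The RMW and the fence-free search after it leave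
persistent memory as it is in `C`. Hence a crash in `C` and a crash after the successful search lead
to the same configuration, and recovery followed by a new search returns the same response in both.
After the crash in `C` this response must be false, again because no key write has occurred. After
the other crash it must be true, because a completed search has already found `v` and nothing
removes it. `false_of_first_write` derives this contradiction. -/

namespace PSet

/-! ### Runs: determinism, solo steps and indistinguishability -/

section Runs

variable {B V S R : Type*} {I : Implementation B V S R}

/-- `e` is a step that `p` takes inside an operation, other than its response. -/
def Event.IsInternal : Event B → ℕ → Prop
  | .rmw q _, p => q = p
  | .flush q _, p => q = p
  | .fence q, p => q = p
  | _, _ => False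

theorem Event.IsInternal.by {e : Event B} {p : ℕ} (h : e.IsInternal p) : e.By p := by
  cases e <;> simp_all [Event.IsInternal, Event.By]

theorem Event.IsInternal.ne_respond {e : Event B} {p : ℕ} (h : e.IsInternal p) (q : ℕ) (r : Bool) :
    e ≠ .respond q r := by
  rintro rfl; exact h

theorem Event.IsInternal.ne_invoke {e : Event B} {p : ℕ} (h : e.IsInternal p) (q : ℕ) (o : SetOp) :
    e ≠ .invoke q o := by
  rintro rfl; exact h

theorem Event.IsInternal.ne_crash {e : Event B} {p : ℕ} (h : e.IsInternal p) : e ≠ .crash := by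
  rintro rfl; exact h

theorem Event.IsRecovery.ne_crash {e : Event B} (h : e.IsRecovery) : e ≠ .crash := by
  rintro rfl; exact h

theorem Event.IsRecovery.ne_invoke {e : Event B} (h : e.IsRecovery) (q : ℕ) (o : SetOp) :
    e ≠ .invoke q o := by
  rintro rfl; exact h

theorem Step.deterministic {C D D' : Config B V S R} {e : Event B} (h : Step I C e D)
    (h' : Step I C e D') : D = D' := by
  cases h <;> cases h' <;> simp_all

theorem Run.append {C D F : Config B V S R} {es fs : List (Event B)} (h : Run I C es D)
    (h' : Run I D fs F) : Run I C (es ++ fs) F := by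
  induction h with
  | nil => exact h'
  | cons hs _ ih => exact .cons hs (ih h')

theorem Run.of_append {C F : Config B V S R} {es fs : List (Event B)} (h : Run I C (es ++ fs) F) :
    ∃ D, Run I C es D ∧ Run I D fs F := by
  induction es generalizing C with
  | nil => exact ⟨C, .nil C, h⟩
  | cons e es ih =>
    cases h with
    | cons hs ht =>
      obtain ⟨D, h1, h2⟩ := ih ht
      exact ⟨D, .cons hs h1, h2⟩

theorem Run.singleton {C D : Config B V S R} {e : Event B} (h : Step I C e D) : Run I C [e] D :=
  .cons h (.nil D)

theorem Run.step_of_singleton {C D : Config B V S R} {e : Event B} (h : Run I C [e] D) :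
    Step I C e D := by
  cases h with
  | cons hs ht => cases ht; exact hs

theorem Run.deterministic {C D D' : Config B V S R} {es : List (Event B)} (h : Run I C es D)
    (h' : Run I C es D') : D = D' := by
  induction h with
  | nil => cases h'; rfl
  | cons hs _ ih =>
    cases h' with
    | cons hs' ht' =>
      cases hs.deterministic hs'
      exact ih ht'

/-- A process that is executing an operation, outside recovery. -/
def Config.Running (C : Config B V S R) (p : ℕ) : Prop :=
  C.recovery = none ∧ ∃ s, C.proc p = .busy s

/-- A busy process cannot invoke, so its response is its only event that is not internal. -/
theorem Step.internal {C D : Config B V S R} {e : Event B} {p : ℕ} (h : Step I C e D)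
    (hC : C.Running p) (he : e.By p) (hr : ∀ r, e ≠ .respond p r) :
    e.IsInternal p ∧ D.Running p := by
  obtain ⟨h0, s, hs⟩ := hC
  cases h <;> simp_all [Event.By, Event.IsInternal, Config.Running]

theorem Run.internal {C D : Config B V S R} {es : List (Event B)} {p : ℕ} (h : Run I C es D)
    (hC : C.Running p) (he : ∀ e ∈ es, e.By p ∧ ∀ r, e ≠ .respond p r) :
    (∀ e ∈ es, e.IsInternal p) ∧ D.Running p := by
  induction h with
  | nil => exact ⟨by simp, hC⟩
  | cons hs _ ih =>
    obtain ⟨h1, h2⟩ := hs.internal hC (he _ (by simp)).1 (he _ (by simp)).2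
    obtain ⟨h3, h4⟩ := ih h2 fun e h => he e (by simp [h])
    exact ⟨by simpa using ⟨h1, h3⟩, h4⟩

/-- The last disjunct is the crux: only a value-changing RMW, the kind of event that can be a key
write, can affect what another process sees in volatile memory. -/
theorem Step.of_by {C D : Config B V S R} {e : Event B} {p : ℕ} (h : Step I C e D)
    (he : e.By p) :
    D.recovery = C.recovery ∧ (∀ q, q ≠ p → D.proc q = C.proc q) ∧
      (D.vol = C.vol ∨ ∃ b, e = .rmw p b ∧ D.vol b ≠ C.vol b) := by
  cases h <;> simp only [Event.By] at he <;> subst he <;>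
    refine ⟨rfl, fun q hq => by simp [Function.update_of_ne hq], ?_⟩
  case rmw s b f _ _ _ =>
    by_cases hb : (f (C.vol b)).1 = C.vol b
    · left; simp [hb]
    · right; exact ⟨b, rfl, by simpa using hb⟩
  all_goals exact Or.inl rfl

/-- An explicit flush only becomes pending and background flushes belong to no process, so a fence
is the only step of a process that writes persistent memory. -/
theorem Step.nvm_eq {C D : Config B V S R} {e : Event B} {p : ℕ} (h : Step I C e D)
    (he : e.By p) (hf : e ≠ .fence p) : D.nvm = C.nvm := by
  cases h <;> simp_all [Event.By]

theorem Run.nvm_eq {C D : Config B V S R} {es : List (Event B)} {p : ℕ} (h : Run I C es D)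
    (he : ∀ e ∈ es, e.By p ∧ e ≠ .fence p) : D.nvm = C.nvm := by
  induction h with
  | nil => rfl
  | cons hs _ ih =>
    rw [ih fun e h => he e (by simp [h]), hs.nvm_eq (he _ (by simp)).1 (he _ (by simp)).2]

/-- `p` cannot tell the two configurations apart. -/
def Config.Similar (p : ℕ) (C C' : Config B V S R) : Prop :=
  C'.vol = C.vol ∧ C'.recovery = C.recovery ∧ C'.proc p = C.proc p

/-- Persistent memory and pending flushes affect neither the enabledness of a step of `p` nor its
effect on volatile memory and on the state of `p`. -/
theorem Step.transfer {C D C' : Config B V S R} {e : Event B} {p : ℕ} (h : Step I C e D)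
    (he : e.By p) (hC : C.Similar p C') : ∃ D', Step I C' e D' ∧ D.Similar p D' := by
  obtain ⟨hv, hr, hp⟩ := hC
  cases h <;> simp only [Event.By] at he <;> subst he
  case invoke s o h1 h2 =>
    exact ⟨_, .invoke C' _ s o (hr.trans h1) (hp.trans h2), by simp [Config.Similar, *]⟩
  case rmw s b f h1 h2 h3 =>
    exact ⟨_, .rmw C' _ s b f (hr.trans h1) (hp.trans h2) h3, by simp [Config.Similar, *]⟩
  case flush s b s' h1 h2 h3 =>
    exact ⟨_, .flush C' _ s b s' (hr.trans h1) (hp.trans h2) h3, by simp [Config.Similar, *]⟩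
  case fence s s' h1 h2 h3 =>
    exact ⟨_, .fence C' _ s s' (hr.trans h1) (hp.trans h2) h3, by simp [Config.Similar, *]⟩
  case respond s r s' h1 h2 h3 =>
    exact ⟨_, .respond C' _ s r s' (hr.trans h1) (hp.trans h2) h3, by simp [Config.Similar, *]⟩

theorem Run.transfer {C D C' : Config B V S R} {es : List (Event B)} {p : ℕ} (h : Run I C es D)
    (he : ∀ e ∈ es, e.By p) (hC : C.Similar p C') : ∃ D', Run I C' es D' := by
  induction h generalizing C' with
  | nil => exact ⟨C', .nil C'⟩
  | cons hs _ ih =>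
    obtain ⟨D', h1, h2⟩ := hs.transfer (he _ (by simp)) hC
    obtain ⟨F, h3⟩ := ih (fun e h => he e (by simp [h])) h2
    exact ⟨F, .cons h1 h3⟩

theorem SoloReturns.transfer {C C' : Config B V S R} {p : ℕ} {q : SetOp} {r : Bool}
    (h : SoloReturns I C p q r) (hC : C.Similar p C') : SoloReturns I C' p q r := by
  obtain ⟨es, D, hrun, hes⟩ := h
  obtain ⟨D', h'⟩ := hrun.transfer (p := p) (by
    intro e he
    simp only [List.mem_cons, List.mem_append, List.not_mem_nil, or_false] at he
    rcases he with rfl | he | rfl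
    exacts [rfl, (hes e he).1, rfl]) hC
  exact ⟨es, D', h', hes⟩

theorem Step.invoke_running {C D : Config B V S R} {p : ℕ} {o : SetOp}
    (h : Step I C (.invoke p o) D) :
    D.Running p ∧ ∃ s, C.proc p = .idle s := by
  cases h
  exact ⟨⟨by assumption, _, Function.update_self ..⟩, _, by assumption⟩

/-- The events of a solo operation are internal. -/
theorem SoloReturns.exists_internal {C : Config B V S R} {p : ℕ} {q : SetOp} {r : Bool}
    (h : SoloReturns I C p q r) :
    (∃ s, C.proc p = .idle s) ∧ ∃ (es : List (Event B)) (D : Config B V S R),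
      Run I C (.invoke p q :: (es ++ [.respond p r])) D ∧ ∀ e ∈ es, e.IsInternal p := by
  obtain ⟨es, D, hrun, hes⟩ := h
  have hrun' := hrun
  cases hrun with
  | cons hs ht =>
    obtain ⟨F, h1, -⟩ := ht.of_append
    exact ⟨hs.invoke_running.2, es, D, hrun', (h1.internal hs.invoke_running.1 hes).1⟩

end Runs

/-! ### Termination of solo operations and of recovery -/

section Termination

variable {B V S R : Type*} {I : Implementation B V S R}

/-- If the steps described by `P` and `E` cannot go on forever, they lead to `Q`. -/
theorem exists_run_of_no_infiniteRun {C : Config B V S R} (P Q : Config B V S R → Prop)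
    (E : Event B → Prop) (hE : ∀ e, E e → e ≠ .crash)
    (hreach : ∃ es, Run I I.initConfig es C) (hP : P C)
    (next : ∀ C, P C → Q C ∨ ∃ e D, Step I C e D ∧ E e ∧ P D)
    (hfin : ∀ σ ev, InfiniteRun I σ ev → ¬ ∀ n, E (ev n)) :
    ∃ es D, Run I C es D ∧ (∀ e ∈ es, E e) ∧ P D ∧ Q D := by
  by_contra hcon
  -- If the claim fails, `Q` fails at every configuration reached through `P` and `E`, so `next`
  -- always provides another step. Iterating these choices gives a forbidden infinite run.
  have hstep : ∀ X : {X : Config B V S R // P X ∧ ∃ es, Run I C es X ∧ ∀ e ∈ es, E e},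
      ∃ (e : Event B) (Y : {X : Config B V S R // P X ∧ ∃ es, Run I C es X ∧ ∀ e ∈ es, E e}),
        Step I X.1 e Y.1 ∧ E e := by
    rintro ⟨X, hX, es, hrun, hes⟩
    rcases next X hX with hQ | ⟨e, D, hs, he, hD⟩
    · exact absurd ⟨es, X, hrun, hes, hX, hQ⟩ hcon
    · refine ⟨e, ⟨D, hD, es ++ [e], hrun.append (.singleton hs), ?_⟩, hs, he⟩
      intro e' he'
      rcases List.mem_append.1 he' with h | h
      · exact hes e' h
      · rw [List.mem_singleton.1 h]; exact he
  choose ev nx h1 h2 using hstep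
  let σ := fun n => nx^[n] ⟨C, hP, [], .nil C, by simp⟩
  refine hfin (fun n => (σ n).1) (fun n => ev (σ n)) ⟨hreach, fun n => ?_, fun n => ?_⟩
    fun n => h2 _
  · have : σ (n + 1) = nx (σ n) := Function.iterate_succ_apply' ..
    simpa only [this] using h1 (σ n)
  · exact hE _ (h2 _)

theorem Implementation.LockFree.exists_response (hI : I.LockFree) {C : Config B V S R} {p : ℕ}
    (hreach : ∃ es, Run I I.initConfig es C) (hC : C.Running p) :
    ∃ es r D, Run I C (es ++ [.respond p r]) D ∧ ∀ e ∈ es, e.IsInternal p := by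
  obtain ⟨es, D, h1, h2, h3, s, r, s', h4, h5⟩ := exists_run_of_no_infiniteRun (I := I)
    (fun C => C.Running p)
    (fun C => ∃ s r s', C.proc p = .busy s ∧ I.act p s = .respond r s')
    (fun e => e.IsInternal p) (fun e h => h.ne_crash) hreach hC
    (by
      rintro C ⟨h0, s, hs⟩
      cases ha : I.act p s with
      | rmw b f =>
        exact .inr ⟨_, _, .rmw C p s b f h0 hs ha, rfl, h0, _, Function.update_self ..⟩
      | flush b s' =>
        exact .inr ⟨_, _, .flush C p s b s' h0 hs ha, rfl, h0, _, Function.update_self ..⟩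
      | fence s' =>
        exact .inr ⟨_, _, .fence C p s s' h0 hs ha, rfl, h0, _, Function.update_self ..⟩
      | respond r s' => exact .inl ⟨s, r, s', hs, ha⟩)
    (by
      intro σ ev hσ hev
      obtain ⟨n, q, r, h⟩ := hI σ ev hσ ⟨p, fun N => ⟨N, le_rfl, (hev N).by⟩⟩
      exact (hev n).ne_respond q r h)
  exact ⟨es, r, _, h1.append (.singleton (.respond D p s r s' h3.1 h4 h5)), h2⟩

theorem Implementation.LockFree.exists_soloReturns (hI : I.LockFree) {C : Config B V S R} {p : ℕ}
    (hreach : ∃ es, Run I I.initConfig es C) (hr : C.recovery = none)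
    (hp : ∃ s, C.proc p = .idle s) (o : SetOp) : ∃ r, SoloReturns I C p o r := by
  obtain ⟨s, hs⟩ := hp
  obtain ⟨es₀, hes₀⟩ := hreach
  have hstep := Step.invoke (I := I) C p s o hr hs
  obtain ⟨es, r, D, h1, h2⟩ := hI.exists_response ⟨_, hes₀.append (.singleton hstep)⟩
    hstep.invoke_running.1
  exact ⟨r, es, D, .cons hstep h1, fun e he => ⟨(h2 e he).by, (h2 e he).ne_respond p⟩⟩

/-- Recovery leaves the process states alone, so processes reset to idle by the crash are still idle
afterwards and can invoke a search. -/
theorem Implementation.RecoveryTerminates.exists_run (hI : I.RecoveryTerminates)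
    {C : Config B V S R} (hreach : ∃ es, Run I I.initConfig es C) (hC : C.recovery ≠ none) :
    ∃ es D, Run I C es D ∧ (∀ e ∈ es, e.IsRecovery) ∧ D.recovery = none ∧ D.proc = C.proc := by
  obtain ⟨es, D, h1, h2, h3, r, h4, h5⟩ := exists_run_of_no_infiniteRun (I := I)
    (fun D => D.recovery ≠ none ∧ D.proc = C.proc)
    (fun D => ∃ r, D.recovery = some r ∧ I.recAct r = .done)
    (fun e => e.IsRecovery) (fun e h => h.ne_crash) hreach ⟨hC, rfl⟩
    (by
      rintro C ⟨h0, hp⟩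
      obtain ⟨r, hr⟩ := Option.ne_none_iff_exists'.1 h0
      cases ha : I.recAct r with
      | rmw b f => exact .inr ⟨_, _, .recRmw C r b f hr ha, trivial, by simp, hp⟩
      | flush b s' => exact .inr ⟨_, _, .recFlush C r b s' hr ha, trivial, by simp, hp⟩
      | fence s' => exact .inr ⟨_, _, .recFence C r s' hr ha, trivial, by simp, hp⟩
      | done => exact .inl ⟨r, hr, ha⟩)
    (fun σ ev hσ hev => hI σ ev hσ fun N => ⟨N, le_rfl, hev N⟩)
  refine ⟨es ++ [.recDone], { D with rpend := ∅, recovery := none },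
    h1.append (.singleton (.recDone D r h4 h5)), ?_, rfl, h3.2⟩
  intro e he
  rcases List.mem_append.1 he with h | h
  · exact h2 e h
  · rw [List.mem_singleton.1 h]; trivial

end Termination

/-! ### Histories, legal sequences and key writes -/

section Histories

variable {B V S R : Type*} {I : Implementation B V S R}

theorem ongoingUntil_append {A L T : List (Event B)} {p : ℕ} {o : SetOp}
    (h : ∀ e ∈ L, e ≠ .crash ∧ ∀ r, e ≠ .respond p r) {n : ℕ} (hn : n ≤ L.length) :
    OngoingUntil (A ++ .invoke p o :: (L ++ T)) A.length p (A.length + 1 + n) := by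
  refine ⟨⟨o, by simp⟩, by omega, fun m h1 h2 => ?_⟩
  obtain ⟨k, rfl⟩ : ∃ k, m = A.length + (k + 1) := ⟨m - A.length - 1, by omega⟩
  have hk : k < L.length := by omega
  have he : (A ++ Event.invoke p o :: (L ++ T))[A.length + (k + 1)]? = some L[k] := by
    rw [List.getElem?_append_right (by omega), Nat.add_sub_cancel_left, List.getElem?_cons_succ,
      List.getElem?_append_left hk, List.getElem?_eq_getElem hk]
  rw [he]
  have := h _ (List.getElem_mem hk)
  exact ⟨by simpa using this.1, fun r => by simpa using this.2 r⟩

theorem getElem?_append_cons_append {A L T : List (Event B)} {a e : Event B} :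
    (A ++ a :: (L ++ e :: T))[A.length + 1 + L.length]? = some e := by
  rw [List.getElem?_append_right (by omega),
    show A.length + 1 + L.length - A.length = L.length + 1 by omega, List.getElem?_cons_succ,
    List.getElem?_append_right le_rfl]
  simp

theorem respondsAt_append {A L T : List (Event B)} {p : ℕ} {o : SetOp} {r : Bool}
    (h : ∀ e ∈ L, e.IsInternal p) :
    RespondsAt (A ++ .invoke p o :: (L ++ .respond p r :: T)) A.length p
      (A.length + 1 + L.length) r :=
  ⟨ongoingUntil_append (fun e he => ⟨(h e he).ne_crash, (h e he).ne_respond p⟩) le_rfl,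
    getElem?_append_cons_append⟩

theorem RespondsAt.unique {es : List (Event B)} {i p j j' : ℕ} {r r' : Bool}
    (h : RespondsAt es i p j r) (h' : RespondsAt es i p j' r') : j = j' ∧ r = r' := by
  obtain ⟨⟨-, h1, h2⟩, h3⟩ := h
  obtain ⟨⟨-, h1', h2'⟩, h3'⟩ := h'
  have : j = j' := by
    rcases lt_trichotomy j j' with hj | hj | hj
    · exact absurd h3 ((h2' j h1 hj).2 r)
    · exact hj
    · exact absurd h3' ((h2 j' h1' hj).2 r')
  subst this
  rw [h3] at h3'
  simpa using h3'

/-- The record, in a strict linearization, of an operation that responds. -/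
theorem IsStrictLinearization.exists_record {es : List (Event B)} {l : List OpRecord}
    (hl : IsStrictLinearization es l) {i p j : ℕ} {r : Bool} {o : SetOp}
    (hi : es[i]? = some (.invoke p o)) (h : RespondsAt es i p j r) :
    (⟨p, o, i, j, r⟩ : OpRecord) ∈ l := by
  obtain ⟨x, hx, rfl⟩ := hl.total i p j r h
  obtain ⟨h1, -, -, h2⟩ := hl.completes x hx
  rw [hi] at h1
  simp only [Option.some.injEq, Event.invoke.injEq] at h1
  obtain ⟨rfl, rfl⟩ := h1
  rcases h2 with h2 | h2
  · obtain ⟨rfl, rfl⟩ := h.unique h2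
    exact hx
  · exact absurd ⟨j, r, h⟩ h2

/-- Only an insertion can bring `v` into the set, and the first `insert v` in the list finds `v`
absent, so it succeeds. -/
theorem Legal.exists_insert {v : ℤ} {x : OpRecord} (hx : x.op = .contains v) (hr : x.ret = true) :
    ∀ {s : Finset ℤ} {l : List OpRecord}, Legal s l → v ∉ s → x ∈ l →
      ∃ y ∈ l, y.op = .insert v ∧ y.ret = true
  | _, [], _, _, hm => by simp at hm
  | s, y :: l, ⟨h1, h2⟩, hv, hm => by
    by_cases hy : y.op = .insert v
    · refine ⟨y, by simp, hy, ?_⟩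
      rw [← h1, hy]
      simp [SetOp.apply, hv]
    · have hv' : v ∉ (y.op.apply s).1 := by
        cases ho : y.op with
        | insert u =>
          have : v ≠ u := by rintro rfl; exact hy ho
          simp [SetOp.apply, hv, this]
        | remove u => simp [SetOp.apply, hv]
        | contains u => simpa [SetOp.apply] using hv
      rcases List.mem_cons.1 hm with rfl | hm
      · rw [hx] at h1
        simp [SetOp.apply, hr, hv] at h1
      · obtain ⟨z, hz, h⟩ := Legal.exists_insert hx hr h2 hv' hm
        exact ⟨z, by simp [hz], h⟩

theorem Legal.contains_true_of_mem {v : ℤ} {x : OpRecord} (hx : x.op = .contains v) :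
    ∀ {s : Finset ℤ} {l : List OpRecord}, Legal s l → v ∈ s → (∀ y ∈ l, y.op ≠ .remove v) →
      x ∈ l → x.ret = true
  | _, [], _, _, _, hm => by simp at hm
  | s, y :: l, ⟨h1, h2⟩, hv, hrem, hm => by
    rcases List.mem_cons.1 hm with rfl | hm
    · rw [← h1, hx]
      simp [SetOp.apply, hv]
    · refine Legal.contains_true_of_mem hx h2 ?_ (fun y hy => hrem y (by simp [hy])) hm
      cases ho : y.op with
      | insert u => simp [SetOp.apply, hv]
      | remove u =>
        have : v ≠ u := by rintro rfl; exact hrem y (by simp) ho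
        simp [SetOp.apply, hv, this]
      | contains u => simpa [SetOp.apply] using hv

/-- Without removals of `v`, a search for `v` that follows an insertion of `v` or a successful search
for `v` is successful. -/
theorem Legal.contains_true {v : ℤ} {x y : OpRecord} (hx : x.op = .contains v)
    (hy : y.op = .insert v ∨ y.op = .contains v ∧ y.ret = true) (hxy : x ≠ y) :
    ∀ {s : Finset ℤ} {l : List OpRecord}, Legal s l → (l.Pairwise fun a b => ¬ b.Precedes a) →
      y.Precedes x → (∀ z ∈ l, z.op ≠ .remove v) → x ∈ l → y ∈ l → x.ret = true
  | _, [], _, _, _, _, hm, _ => by simp at hm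
  | s, z :: l, ⟨h1, h2⟩, hl, hp, hrem, hm, hm' => by
    have hrem' : ∀ z ∈ l, z.op ≠ .remove v := fun y hy => hrem y (by simp [hy])
    rw [List.pairwise_cons] at hl
    rcases List.mem_cons.1 hm with rfl | hmx
    · rcases List.mem_cons.1 hm' with h | h
      · exact absurd h.symm hxy
      -- Here `x` would be linearized before `y`, against the precedence order.
      · exact absurd hp (hl.1 y h)
    · rcases List.mem_cons.1 hm' with rfl | hmy
      · refine h2.contains_true_of_mem hx ?_ hrem' hmx
        -- Either way `v` is in the set after `y`: it was just inserted, or the successful search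
        -- shows that it was already there. The response of the insertion is irrelevant.
        rcases hy with hy | ⟨hy, hr⟩
        · simp [hy, SetOp.apply]
        · rw [hy, hr] at h1
          rw [hy]
          simpa [SetOp.apply] using h1
      · exact h2.contains_true hx hy hxy hl.2 hp hrem' hmx hmy

theorem IsStrictLinearization.op_ne {es : List (Event B)} {l : List OpRecord}
    (hl : IsStrictLinearization es l) {o : SetOp} (h : ∀ e ∈ es, ∀ q, e ≠ .invoke q o) :
    ∀ z ∈ l, z.op ≠ o := by
  rintro z hz rfl
  exact h _ (List.mem_of_getElem? (hl.completes z hz).1) _ rfl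

theorem IsStrictLinearization.ret_eq_true {es : List (Event B)} {l : List OpRecord}
    (hl : IsStrictLinearization es l) {v : ℤ} (hrem : ∀ e ∈ es, ∀ q, e ≠ .invoke q (.remove v))
    {i p j i' p' j' : ℕ} {r r' : Bool} {o : SetOp}
    (hi : es[i]? = some (.invoke p o)) (h : RespondsAt es i p j r)
    (ho : o = .insert v ∨ o = .contains v ∧ r = true)
    (hi' : es[i']? = some (.invoke p' (.contains v))) (h' : RespondsAt es i' p' j' r')
    (hj : j ≤ i') : r' = true := by
  have hlt : i < j := h.1.2.1
  refine hl.legal.contains_true (x := ⟨p', .contains v, i', j', r'⟩) (y := ⟨p, o, i, j, r⟩) rfl ho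
    ?_ hl.order hj (hl.op_ne hrem) (hl.exists_record hi' h') (hl.exists_record hi h)
  intro heq
  have : i' = i := congrArg OpRecord.inv heq
  omega

/-- Being a key write depends only on the execution up to and including the write. This allows
comparing executions that continue differently, such as with a crash. -/
theorem IsKeyWrite.congr {es es' : List (Event B)} {n i p w : ℕ} {o : SetOp}
    (h : IsKeyWrite I es i p o w) (hw : w < n) (ht : es.take n = es'.take n) :
    IsKeyWrite I es' i p o w := by
  have hget : ∀ k, k < n → es[k]? = es'[k]? := by
    intro k hk
    rw [← List.getElem?_take_of_lt hk, ht, List.getElem?_take_of_lt hk]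
  have htake : ∀ k, k ≤ n → es.take k = es'.take k := by
    intro k hk
    have := congrArg (List.take k) ht
    simpa [List.take_take, min_eq_left hk] using this
  obtain ⟨h1, ⟨h2, h3, h4⟩, b, C, D, h5, h6, h7, h8⟩ := h
  have hi : es[i]? = es'[i]? := hget i (by omega)
  refine ⟨hi ▸ h1, ⟨hi ▸ h2, h3, fun m hm hm' => ?_⟩, b, C, D, ?_, ?_, ?_, h8⟩
  · rw [← hget m (by omega)]; exact h4 m hm hm'
  · rw [← hget w hw]; exact h5
  · rw [← htake w hw.le]; exact h6
  · rw [← htake (w + 1) hw]; exact h7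

/-- If a search for `v` is successful, the only insertion of `v` has a key write before the crash at
which it is pending. -/
theorem SLEExecution.exists_isKeyWrite {es : List (Event B)} (h : SLEExecution I es) {v : ℤ}
    {i p c : ℕ} (hi : es[i]? = some (.invoke p (.insert v)))
    (huniq : ∀ k q, es[k]? = some (.invoke q (.insert v)) → k = i)
    (hc : PendingAtCrash es i p c) {k q j : ℕ}
    (hk : es[k]? = some (.invoke q (.contains v))) (hj : RespondsAt es k q j true) :
    ∃ w, w < c ∧ IsKeyWrite I es i p (.insert v) w := by
  obtain ⟨l, hl, hkey⟩ := h
  -- The set is initially empty, so the successful search needs a successful insertion of `v`, which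
  -- by uniqueness is the one at index `i`.
  obtain ⟨y, hy, hop, hret⟩ := Legal.exists_insert (v := v) (x := ⟨q, .contains v, k, j, true⟩)
    rfl rfl hl.legal (by simp) (hl.exists_record hk hj)
  have hinv := (hl.completes y hy).1
  rw [hop] at hinv
  have hyi := huniq _ _ hinv
  rw [hyi, hi] at hinv
  simp only [Option.some.injEq, Event.invoke.injEq, and_true] at hinv
  have := hkey y hy (by simp [hop, SetOp.IsUpdate, SetOp.IsReadOnly]) hret c
    (by rw [hyi, ← hinv]; exact hc)
  rwa [hyi, ← hinv, hop] at this

theorem not_commutes_insert_contains (v : ℤ) : ¬ (SetOp.insert v).Commutes (.contains v) := by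
  intro h
  have := (h ∅).2.2
  simp [SetOp.apply] at this

theorem eq_contains_of_not_commutes_insert {v : ℤ} {q : SetOp} (hq : q.IsReadOnly)
    (h : ¬ (SetOp.insert v).Commutes q) : q = .contains v := by
  cases q with
  | insert u => exact hq.elim
  | remove u => exact hq.elim
  | contains u =>
    by_contra hne
    have hne' : u ≠ v := by rintro rfl; exact hne rfl
    exact h fun s => by by_cases hv : v ∈ s <;> simp [SetOp.apply, hne', hv]

end Histories

/-! ### The first key write and its loss in a crash -/

section Impossibility

variable {B V S R : Type*} {I : Implementation B V S R}

theorem Implementation.PersistenceFreeSearches.not_fence (hI : I.PersistenceFreeSearches)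
    {pre L T : List (Event B)} {D : Config B V S R} {p : ℕ} {o : SetOp} (ho : o.IsReadOnly)
    (h : Run I I.initConfig (pre ++ .invoke p o :: (L ++ T)) D) (hL : ∀ e ∈ L, e.IsInternal p) :
    ∀ e ∈ L, e ≠ .fence p := by
  rintro _ he rfl
  obtain ⟨n, hn, hLn⟩ := List.getElem_of_mem he
  refine (hI _ ⟨D, h⟩ pre.length (pre.length + 1 + n) p o (by simp) ho
    (ongoingUntil_append (fun e he => ⟨(hL e he).ne_crash, (hL e he).ne_respond p⟩) hn.le)).1 ?_
  rw [List.getElem?_append_right (by omega),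
    show pre.length + 1 + n - pre.length = n + 1 by omega, List.getElem?_cons_succ,
    List.getElem?_append_left hn, List.getElem?_eq_getElem hn, hLn]

/-- In the initial configuration a search is not successful. -/
theorem Implementation.SLELinearizable.soloReturns_init (hI : I.SLELinearizable) (hf : I.LockFree)
    (p : ℕ) (v : ℤ) : SoloReturns I I.initConfig p (.contains v) false := by
  obtain ⟨r, hr⟩ := hf.exists_soloReturns (C := I.initConfig) (p := p) ⟨[], .nil _⟩ rfl ⟨_, rfl⟩
    (.contains v)
  cases r with
  | false => exact hr
  | true =>
    obtain ⟨-, es, D, hrun, hes⟩ := hr.exists_internal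
    obtain ⟨l, hl, -⟩ := hI _ ⟨D, hrun⟩
    have hresp := respondsAt_append (A := []) (T := []) (o := .contains v) (r := true) hes
    obtain ⟨y, hy, hop, -⟩ := Legal.exists_insert (v := v)
      (x := ⟨p, .contains v, 0, 0 + 1 + es.length, true⟩) rfl rfl hl.legal (by simp)
      (hl.exists_record (by simp) hresp)
    refine absurd hop (hl.op_ne ?_ y hy)
    intro e he q
    simp only [List.mem_cons, List.mem_append, List.not_mem_nil, or_false] at he
    rcases he with rfl | he | rfl
    · simp
    · exact (hes e he).ne_invoke _ _
    · simp

/-- A solo insertion has a key write. -/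
theorem Implementation.SLELinearizable.exists_isKeyWrite (hI : I.SLELinearizable)
    (hf : I.LockFree) {p : ℕ} {v : ℤ} {L : List (Event B)} {r : Bool} {F : Config B V S R}
    (hrun : Run I I.initConfig (.invoke p (.insert v) :: (L ++ [.respond p r])) F)
    (hL : ∀ e ∈ L, e.IsInternal p) :
    ∃ w, IsKeyWrite I (.invoke p (.insert v) :: (L ++ [.respond p r])) 0 p (.insert v) w := by
  by_contra hno
  have hne : p + 1 ≠ p := by omega
  -- Without a key write, the response false of a solo search by the idle process `p + 1` persists
  -- after every prefix of the insertion.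
  have key : ∀ n ≤ L.length, ∀ C, Run I I.initConfig (.invoke p (.insert v) :: L.take n) C →
      C.recovery = none ∧ (∃ s, C.proc (p + 1) = .idle s) ∧
        SoloReturns I C (p + 1) (.contains v) false := by
    intro n
    induction n with
    | zero =>
      intro _ C hC
      obtain ⟨h1, h2, h3⟩ := (Run.step_of_singleton hC).of_by (p := p) rfl
      have hvol : C.vol = I.initConfig.vol := by
        rcases h3 with h3 | ⟨b, hb, -⟩
        · exact h3
        · cases hb
      exact ⟨h1, ⟨_, h2 _ hne⟩,
        (hI.soloReturns_init hf (p + 1) v).transfer ⟨hvol, h1, h2 _ hne⟩⟩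
    | succ n ih =>
      intro hn D hD
      have hn' : n < L.length := hn
      have hD' : Run I I.initConfig ((.invoke p (.insert v) :: L.take n) ++ [L[n]]) D := by
        rw [List.cons_append, ← List.take_succ_eq_append_getElem hn']
        exact hD
      obtain ⟨C, hC, hs⟩ := hD'.of_append
      obtain ⟨i1, ⟨s, i2⟩, i3⟩ := ih (by omega) C hC
      have hint := hL _ (List.getElem_mem hn')
      obtain ⟨h1, h2, h3⟩ := hs.step_of_singleton.of_by hint.by
      refine ⟨h1.trans i1, ⟨s, (h2 _ hne).trans i2⟩, ?_⟩
      rcases h3 with h3 | ⟨b, hb, hvol⟩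
      · exact i3.transfer ⟨h3, h1, h2 _ hne⟩
      -- The event changed its object. A solo search that now returned true would make it a key
      -- write, at index `n + 1` because the invocation occupies index 0.
      · obtain ⟨r', hr'⟩ := hf.exists_soloReturns ⟨_, hD⟩ (h1.trans i1)
          ⟨s, (h2 _ hne).trans i2⟩ (.contains v)
        cases r' with
        | false => exact hr'
        | true =>
          refine absurd ⟨n + 1, rfl, ?_, b, C, D, ?_, ?_, ?_, hvol, p + 1, .contains v, false, true,
            trivial, not_commutes_insert_contains v, i3, hr', by simp⟩ hno
          · have := ongoingUntil_append (A := []) (T := [.respond p r]) (o := .insert v)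
              (fun e he => ⟨(hL e he).ne_crash, (hL e he).ne_respond p⟩) hn'.le
            simpa [add_comm] using this
          · rw [List.getElem?_cons_succ, List.getElem?_append_left hn',
              List.getElem?_eq_getElem hn', hb]
          · rw [List.take_succ_cons, List.take_append_of_le_length hn'.le]
            exact hC
          · rw [List.take_succ_cons, List.take_append_of_le_length hn]
            exact hD
  have hrun' : Run I I.initConfig ((.invoke p (.insert v) :: L) ++ [.respond p r]) F := hrun
  obtain ⟨C, hC, hs⟩ := hrun'.of_append
  obtain ⟨-, -, i3⟩ := key L.length le_rfl C (by simpa using hC)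
  obtain ⟨h1, h2, h3⟩ := hs.step_of_singleton.of_by (p := p) rfl
  have hvol : F.vol = C.vol := by
    rcases h3 with h3 | ⟨b, hb, -⟩
    · exact h3
    · cases hb
  -- The search still fails after the insertion has responded, which no linearization allows.
  obtain ⟨-, es, D, hsearch, hes⟩ := (i3.transfer ⟨hvol, h1, h2 _ hne⟩).exists_internal
  have hfull := hrun.append hsearch
  obtain ⟨l, hl, -⟩ := hI _ ⟨D, hfull⟩
  have hr1 : RespondsAt ((Event.invoke p (.insert v) :: (L ++ [.respond p r])) ++
      (.invoke (p + 1) (.contains v) :: (es ++ [.respond (p + 1) false])))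
      0 p (0 + 1 + L.length) r := by
    have := respondsAt_append (A := []) (T := .invoke (p + 1) (.contains v) ::
      (es ++ [.respond (p + 1) false])) (o := .insert v) (r := r) hL
    simpa using this
  have hr2 := respondsAt_append (A := .invoke p (.insert v) :: (L ++ [.respond p r])) (T := [])
    (o := .contains v) (r := false) hes
  have := hl.ret_eq_true (v := v) ?_ (by simp) hr1 (.inl rfl) (by simp) hr2
    (by simp only [List.length_cons, List.length_append, List.length_nil]; omega)
  · simp at this
  · intro e he q
    simp only [List.mem_cons, List.mem_append, List.not_mem_nil, or_false] at he
    rcases he with (rfl | he | rfl) | rfl | he | rfl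
    · simp
    · exact (hL e he).ne_invoke _ _
    · simp
    · simp
    · exact (hes e he).ne_invoke _ _
    · simp

/-- A crash followed by the recovery and a solo search. -/
theorem exists_run_crash_search (hr : I.RecoveryTerminates) (hf : I.LockFree)
    {C : Config B V S R} (hreach : ∃ es, Run I I.initConfig es C) (p : ℕ) (v : ℤ) :
    ∃ (K L : List (Event B)) (r : Bool), (∀ e ∈ K, e.IsRecovery) ∧ (∀ e ∈ L, e.IsInternal p) ∧
      ∀ C' : Config B V S R, C'.nvm = C.nvm → ∃ D,
        Run I C' (.crash :: (K ++ .invoke p (.contains v) :: (L ++ [.respond p r]))) D := by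
  obtain ⟨es₀, h₀⟩ := hreach
  have hcrash := Step.crash (I := I) C
  obtain ⟨K, D, h1, h2, h3, h4⟩ := hr.exists_run ⟨_, h₀.append (.singleton hcrash)⟩ (by simp)
  obtain ⟨r, hsolo⟩ := hf.exists_soloReturns (p := p)
    ⟨_, (h₀.append (.singleton hcrash)).append h1⟩ h3 ⟨_, by rw [h4]⟩ (.contains v)
  obtain ⟨-, L, F, h5, h6⟩ := hsolo.exists_internal
  -- The crash discards everything except persistent memory, so one schedule of recovery and search
  -- serves all `C'`.
  refine ⟨K, L, r, h2, h6, fun C' hC' => ⟨F, .cons (.crash C') ?_⟩⟩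
  rw [hC']
  exact h1.append h5

/-- If an insertion of `v` by `p` is cut off by a crash after its events `a`, and some search for `v`
is successful, then the insertion has a key write among the events of `a`. -/
theorem Implementation.SLELinearizable.exists_isKeyWrite_le (hI : I.SLELinearizable)
    {p : ℕ} {v : ℤ} {a X T : List (Event B)} {G : Config B V S R}
    (hrun : Run I I.initConfig (.invoke p (.insert v) :: ((a ++ X) ++ .crash :: T)) G)
    (ha : ∀ e ∈ a, e.IsInternal p) (hX : ∀ e ∈ X, e ≠ .crash ∧ ¬ e.By p)
    (hins : ∀ e ∈ X ++ T, ∀ q, e ≠ .invoke q (.insert v)) {k q j : ℕ}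
    (hk : (Event.invoke p (.insert v) :: ((a ++ X) ++ .crash :: T))[k]? =
      some (.invoke q (.contains v)))
    (hj : RespondsAt (.invoke p (.insert v) :: ((a ++ X) ++ .crash :: T)) k q j true) :
    ∃ w, w ≤ a.length ∧
      IsKeyWrite I (.invoke p (.insert v) :: ((a ++ X) ++ .crash :: T)) 0 p (.insert v) w := by
  have hpend : PendingAtCrash (Event.invoke p (.insert v) :: ((a ++ X) ++ .crash :: T)) 0 p
      (0 + 1 + (a ++ X).length) := by
    refine ⟨ongoingUntil_append (A := []) ?_ le_rfl, getElem?_append_cons_append (A := [])⟩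
    intro e he
    rcases List.mem_append.1 he with he | he
    · exact ⟨(ha e he).ne_crash, (ha e he).ne_respond p⟩
    · exact ⟨(hX e he).1, by rintro r rfl; exact (hX _ he).2 rfl⟩
  have huniq : ∀ k q, (Event.invoke p (.insert v) :: ((a ++ X) ++ .crash :: T))[k]? =
      some (.invoke q (.insert v)) → k = 0 := by
    intro k q hk
    cases k with
    | zero => rfl
    | succ k =>
      have := List.mem_of_getElem? (List.getElem?_cons_succ ▸ hk)
      simp only [List.mem_append, List.mem_cons, reduceCtorEq, false_or, or_assoc] at this
      rcases this with h | h | h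
      · exact absurd rfl ((ha _ h).ne_invoke q _)
      · exact absurd rfl (hins _ (List.mem_append_left _ h) q)
      · exact absurd rfl (hins _ (List.mem_append_right _ h) q)
  obtain ⟨w, hw, hkey⟩ := (hI _ ⟨G, hrun⟩).exists_isKeyWrite (by simp) huniq hpend hk hj
  refine ⟨w, ?_, hkey⟩
  -- A key write is an event of `p`, and none of the events in `X` is.
  by_contra! hlt
  obtain ⟨-, -, b, -, -, hget, -⟩ := hkey
  obtain ⟨m, rfl⟩ : ∃ m, w = a.length + m + 1 := ⟨w - a.length - 1, by omega⟩
  rw [List.length_append] at hw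
  rw [List.getElem?_cons_succ, List.append_assoc, List.getElem?_append_right (by omega),
    Nat.add_sub_cancel_left, List.getElem?_append_left (by omega)] at hget
  exact (hX _ (List.mem_of_getElem? hget)).2 rfl

/-- The first write of an insertion that can be a key write cannot change the response of a solo
search: it is lost in a crash, although a successful search may have observed it. -/
theorem Implementation.SLELinearizable.false_of_first_write (hI : I.SLELinearizable)
    (hr : I.RecoveryTerminates) (hf : I.LockFree) (hp : I.PersistenceFreeSearches)
    {p p' : ℕ} {v : ℤ} {a : List (Event B)} {b : B} {C D : Config B V S R} {x x' : Bool}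
    (ha : ∀ e ∈ a, e.IsInternal p)
    (hC : Run I I.initConfig (.invoke p (.insert v) :: a) C)
    (hD : Run I I.initConfig (.invoke p (.insert v) :: (a ++ [.rmw p b])) D)
    (hno : ∀ (T : List (Event B)) (w : ℕ), w ≤ a.length →
      ¬ IsKeyWrite I (.invoke p (.insert v) :: (a ++ T)) 0 p (.insert v) w)
    (hsC : SoloReturns I C p' (.contains v) x) (hsD : SoloReturns I D p' (.contains v) x')
    (hne : x ≠ x') : False := by
  have hCrun : C.Running p := by
    cases hC with
    | cons hs ht =>
      exact (ht.internal hs.invoke_running.1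
        fun e he => ⟨(ha e he).by, (ha e he).ne_respond p⟩).2
  obtain ⟨⟨s', hs'⟩, L₁, F₁, hrun₁, hL₁⟩ := hsC.exists_internal
  -- At `C` the searcher `p'` is idle, while `p` is inside its insertion.
  have hpp : p' ≠ p := by
    rintro rfl
    obtain ⟨-, s, hs⟩ := hCrun
    rw [hs] at hs'
    cases hs'
  -- the search before the write is not successful
  have hx : x = false := by
    by_contra hx
    have hx : x = true := by simpa using hx
    subst hx
    -- The crash is appended because SLE linearizability demands key writes only of updates pending
    -- at a crash.
    have hrun : Run I I.initConfig (.invoke p (.insert v) ::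
        ((a ++ .invoke p' (.contains v) :: (L₁ ++ [.respond p' true])) ++ .crash :: [])) _ :=
      (hC.append hrun₁).append (.singleton (.crash F₁))
    have hj := respondsAt_append (A := .invoke p (.insert v) :: a) (T := [.crash])
      (o := .contains v) (r := true) hL₁
    have hX : ∀ e ∈ Event.invoke p' (.contains v) :: (L₁ ++ [Event.respond p' true]),
        e ≠ .crash ∧ ¬ e.By p := by
      intro e he
      simp only [List.mem_cons, List.mem_append, List.not_mem_nil, or_false] at he
      rcases he with rfl | he | rfl
      · exact ⟨by simp, hpp⟩
      · refine ⟨(hL₁ e he).ne_crash, fun h => hpp ?_⟩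
        have := (hL₁ e he).by
        cases e <;> simp_all [Event.By]
      · exact ⟨by simp, hpp⟩
    have hins : ∀ e ∈ (Event.invoke p' (.contains v) :: (L₁ ++ [Event.respond p' true])) ++ [],
        ∀ q, e ≠ .invoke q (.insert v) := by
      intro e he q
      simp only [List.mem_cons, List.mem_append, List.not_mem_nil, or_false] at he
      rcases he with rfl | he | rfl
      · simp
      · exact (hL₁ e he).ne_invoke _ _
      · simp
    obtain ⟨w, hw, hkey⟩ := hI.exists_isKeyWrite_le hrun ha hX hins (k := a.length + 1) (q := p')
      (j := a.length + 1 + 1 + L₁.length) (by simp) (by simpa using hj)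
    rw [List.append_assoc] at hkey
    exact hno _ w hw hkey
  have hx' : x' = true := by subst hx; simpa using hne.symm
  subst hx'
  -- neither the write nor the search after it changes persistent memory
  obtain ⟨-, L, F, hrunL, hL⟩ := hsD.exists_internal
  have hnvm : F.nvm = C.nvm := by
    have h1 : D.nvm = C.nvm := by
      obtain ⟨C', hC', hs⟩ := Run.of_append (es := .invoke p (.insert v) :: a) hD
      rw [hC'.deterministic hC] at hs
      exact hs.step_of_singleton.nvm_eq (p := p) rfl (by simp)
    rw [← h1]
    refine hrunL.nvm_eq (p := p') fun e he => ?_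
    have hfence := hp.not_fence (T := [.respond p' true]) (o := .contains v) trivial
      (hD.append hrunL) hL
    simp only [List.mem_cons, List.mem_append, List.not_mem_nil, or_false] at he
    rcases he with rfl | he | rfl
    · exact ⟨rfl, by simp⟩
    · exact ⟨(hL e he).by, hfence e he⟩
    · exact ⟨rfl, by simp⟩
  -- The schedule found from `C` is replayed from `F`, whose persistent memory is the same. Process
  -- `p` can perform the search since the crash makes it idle.
  obtain ⟨K, M, y, hK, hM, hcrash⟩ := exists_run_crash_search hr hf ⟨_, hC⟩ p v
  obtain ⟨G, hG⟩ := hcrash C rfl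
  obtain ⟨G', hG'⟩ := hcrash F hnvm
  have hKM : ∀ o, o ≠ .contains v → ∀ e ∈ K ++ .invoke p (.contains v) :: (M ++ [.respond p y]),
      ∀ q, e ≠ .invoke q o := by
    intro o ho e he q
    simp only [List.mem_cons, List.mem_append, List.not_mem_nil, or_false] at he
    rcases he with he | rfl | he | rfl
    · exact (hK e he).ne_invoke _ _
    · simpa using fun _ => ho.symm
    · exact (hM e he).ne_invoke _ _
    · simp
  -- after a crash before the write, the search is not successful
  have hy : y = false := by
    by_contra hy
    have hy : y = true := by simpa using hy
    subst hy
    have hrun : Run I I.initConfig (.invoke p (.insert v) ::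
        ((a ++ []) ++ .crash :: (K ++ .invoke p (.contains v) :: (M ++ [.respond p true])))) G := by
      rw [List.append_nil]
      exact hC.append hG
    have hj := respondsAt_append (A := .invoke p (.insert v) :: (a ++ .crash :: K)) (T := [])
      (o := .contains v) (r := true) hM
    have hE : (Event.invoke p (.insert v) ::
        ((a ++ []) ++ .crash :: (K ++ .invoke p (.contains v) :: (M ++ [.respond p true])))) =
      (.invoke p (.insert v) :: (a ++ .crash :: K)) ++
        (.invoke p (.contains v) :: (M ++ [.respond p true])) := by simp
    rw [← hE] at hj
    obtain ⟨w, hw, hkey⟩ := hI.exists_isKeyWrite_le hrun ha (by simp)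
      (by simpa only [List.nil_append] using hKM _ (by simp)) (by rw [hE]; simp) hj
    rw [List.append_nil] at hkey
    exact hno _ w hw hkey
  -- after a crash after the write and the successful search, it is successful
  obtain ⟨l, hl, -⟩ := hI _ ⟨G', (hD.append hrunL).append hG'⟩
  have h1 := respondsAt_append (A := .invoke p (.insert v) :: (a ++ [.rmw p b]))
    (T := .crash :: (K ++ .invoke p (.contains v) :: (M ++ [.respond p y])))
    (o := .contains v) (r := true) hL
  have h2 := respondsAt_append (A := (.invoke p (.insert v) :: (a ++ [.rmw p b])) ++
    .invoke p' (.contains v) :: (L ++ .respond p' true :: .crash :: K)) (T := [])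
    (o := .contains v) (r := y) hM
  have hE : ((Event.invoke p (.insert v) :: (a ++ [.rmw p b])) ++
      .invoke p' (.contains v) :: (L ++ [.respond p' true])) ++
        .crash :: (K ++ .invoke p (.contains v) :: (M ++ [.respond p y])) =
      (.invoke p (.insert v) :: (a ++ [.rmw p b])) ++ .invoke p' (.contains v) ::
        (L ++ .respond p' true :: .crash :: (K ++ .invoke p (.contains v) ::
          (M ++ [.respond p y]))) := by simp
  have hE' : ((Event.invoke p (.insert v) :: (a ++ [.rmw p b])) ++
      .invoke p' (.contains v) :: (L ++ .respond p' true :: .crash :: K)) ++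
        .invoke p (.contains v) :: (M ++ [.respond p y]) =
      (.invoke p (.insert v) :: (a ++ [.rmw p b])) ++ .invoke p' (.contains v) ::
        (L ++ .respond p' true :: .crash :: (K ++ .invoke p (.contains v) ::
          (M ++ [.respond p y]))) := by simp
  rw [hE] at hl
  have hi : ((Event.invoke p (.insert v) :: (a ++ [.rmw p b])) ++ .invoke p' (.contains v) ::
        (L ++ .respond p' true :: .crash :: (K ++ .invoke p (.contains v) ::
          (M ++ [.respond p y]))))[((Event.invoke p (.insert v) ::
          (a ++ [Event.rmw p b])) ++ Event.invoke p' (.contains v) ::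
            (L ++ Event.respond p' true :: Event.crash :: K)).length]? =
      some (.invoke p (.contains v)) := by
    rw [← hE', List.getElem?_append_right le_rfl]; simp
  rw [hE'] at h2
  have := hl.ret_eq_true (v := v) ?_ (by simp) h1 (.inr ⟨rfl, rfl⟩) hi h2
    (by simp only [List.length_cons, List.length_append]; omega)
  · rw [hy] at this
    cases this
  · intro e he q
    simp only [List.mem_append, List.mem_cons, List.not_mem_nil, or_false] at he
    rcases he with (rfl | he | rfl) | rfl | he | rfl | rfl | he
    · simp
    · exact (ha e he).ne_invoke _ _
    · simp
    · simp
    · exact (hL e he).ne_invoke _ _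
    · simp
    · simp
    · exact hKM _ (by simp) e (by simpa using he) q

end Impossibility

end PSet

theorem mainTheorem2 {B V S R : Type*} :
    ¬ ∃ I : PSet.Implementation B V S R,
      I.RecoveryTerminates ∧ I.LockFree ∧ I.SLELinearizable ∧ I.PersistenceFreeSearches := by
  rintro ⟨I, hr, hf, hI, hp⟩
  obtain ⟨r, hsolo⟩ := hf.exists_soloReturns (C := I.initConfig) (p := 0) ⟨[], .nil _⟩ rfl
    ⟨_, rfl⟩ (.insert 0)
  obtain ⟨-, L, F, hrun, hL⟩ := hsolo.exists_internal
  classical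
  have hex := hI.exists_isKeyWrite hf hrun hL
  -- Minimality of the chosen key write excludes every earlier one.
  have hmin := fun m => Nat.find_min hex (m := m)
  obtain ⟨-, ⟨-, hpos, -⟩, b, C, D, hget, hC, hD, -, p', q, x, x', hq, hcomm, hsC, hsD, hne⟩ :=
    Nat.find_spec hex
  obtain rfl := PSet.eq_contains_of_not_commutes_insert hq hcomm
  obtain ⟨n, hn⟩ := Nat.exists_eq_succ_of_ne_zero hpos.ne'
  rw [hn] at hget hC hD hmin
  rw [List.getElem?_cons_succ] at hget
  -- The last event of the execution is the response, not an RMW.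
  have hnL : n < L.length := by
    by_contra! hle
    rw [List.getElem?_append_right hle] at hget
    have := List.mem_of_getElem? hget
    simp at this
  rw [List.getElem?_append_left hnL, List.getElem?_eq_getElem hnL, Option.some.injEq] at hget
  rw [List.take_succ_cons, List.take_append_of_le_length hnL.le] at hC
  rw [List.take_succ_cons, List.take_append_of_le_length hnL,
    List.take_succ_eq_append_getElem hnL, hget] at hD
  have hlen : (L.take n).length = n := by simp [hnL.le]
  refine hI.false_of_first_write hr hf hp (fun e he => hL e (List.mem_of_mem_take he)) hC hD
    -- Any continuation `T` agrees with the solo insertion on the first `n + 1` events, so an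
    -- earlier key write in it would contradict minimality.
    (fun T w hw hkey => hmin w (by omega) (hkey.congr (n := n + 1) (by omega) ?_)) hsC hsD hne
  rw [List.take_succ_cons, List.take_succ_cons, List.take_append_of_le_length hlen.ge,
    List.take_append_of_le_length hnL.le, List.take_take, min_self]
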